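/- (Lévy's second arcsine law.) Let $(B_s)_{s\ge 0}$ be a standard linear Brownian motion started at $B_0=0$ almost surely, and let $t>0$ be fixed. Then the proportion of time that $B$ spends above zero during $[0,t]$, $$\frac1t\int_0^t \mathbf 1_{(0,\infty)}(B_s)\,ds,$$ has the arcsine distribution on $(0,1)$, that is, its law is absolutely continuous with respect to Lebesgue measure with density $$x\mapsto \frac{1}{\pi\sqrt{x(1-x)}}\,\mathbf 1_{(0,1)}(x).$$ -/

import Mathlib

open MeasureTheory ProbabilityTheory
open scoped NNReal ENNReal

/-- The arcsine density `x ↦ 1 / (π √(x (1 - x)))` on `(0, 1)`, and `0` elsewhere. -/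
noncomputable def arcsinePDFReal (x : ℝ) : ℝ :=
  (Set.Ioo (0 : ℝ) 1).indicator (fun y => 1 / (Real.pi * √(y * (1 - y)))) x

/-- The arcsine distribution on `(0, 1)`, given by its density with respect to Lebesgue measure. -/
noncomputable def arcsineMeasure : Measure ℝ :=
  volume.withDensity (fun x => ENNReal.ofReal (arcsinePDFReal x))

/-- The proportion of time `t⁻¹ ∫₀ᵗ 1_{(0, ∞)}(B_s) ds` that the process `B` spends above zero
during `[0, t]`. -/
noncomputable def occupationProportion {Ω : Type*} (B : ℝ≥0 → Ω → ℝ) (t : ℝ) (ω : Ω) : ℝ :=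
  t⁻¹ * ∫ s in (0 : ℝ)..t, (Set.Ioi (0 : ℝ)).indicator (fun _ => (1 : ℝ)) (B s.toNNReal ω)

/-!
Lévy's arcsine law is obtained as the limit of its exact discrete counterpart. Let `Sₖ = B (t k / n)`
for `k ≤ n`. This is a random walk whose increments are independent with a common symmetric law
without atoms, and the proportion of `k ∈ {1, …, n}` with `Sₖ > 0` converges almost surely to the
occupation proportion, because the zero set of a Brownian path is almost surely negligible, by
Fubini (`IsBrownianReal.ae_ae_ne_zero`, `tendsto_card_pos_div`).

The number of positive partial sums is computed following Sparre Andersen. The map `rearrange`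
permutes the increments so that the number of positive partial sums becomes the first time at which
the walk is maximal (`isFirstMaxAt_rearrange`), and it preserves the product measure
(`measurePreserving_rearrange`). At the time of its maximum the walk splits into two independent
pieces, one of which stays positive when read backwards while the other stays nonpositive, so the
number of positive partial sums is `k` with probability `u k * u (n - k)`, where `u k` is the
probability of staying positive for `k` steps (`measureReal_posCount_eq`). As these probabilities sum
to `1` for every `n`, they determine `u`. The beta integrals
`∫ (n choose k) x ^ k (1 - x) ^ (n - k)` against the arcsine law factor in the same way and also sum
to `1`, hence they are the same numbers (`measureReal_posCount_eq_integral`).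

In other words, the number of positive partial sums is a binomial variable with arcsine distributed
success probability. The expectation of `f` at the proportion of positive partial sums is thus the
arcsine integral of the `n`-th Bernstein polynomial of `f`, which converges uniformly to `f`.
-/

/-! ### Walks and the rearrangement of their increments -/

/-- The sum of the first `j` entries of `x` (of all entries when `n ≤ j`). -/
noncomputable def partialSum {n : ℕ} (x : Fin n → ℝ) (j : ℕ) : ℝ :=
  ∑ i : Fin n, if (i : ℕ) < j then x i else 0

/-- The number of `j ∈ {1, …, n}` with positive `j`-th partial sum. -/
noncomputable def posCount {n : ℕ} (x : Fin n → ℝ) : ℕ :=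
  ((Finset.range n).filter fun j => 0 < partialSum x (j + 1)).card

/-- The walk `0 = S₀, S₁, …, Sₙ` of partial sums of `x` attains its maximum at time `k` for the
first time. -/
def IsFirstMaxAt {n : ℕ} (x : Fin n → ℝ) (k : ℕ) : Prop :=
  k ≤ n ∧ (∀ j < k, partialSum x j < partialSum x k) ∧ ∀ j ≤ n, partialSum x j ≤ partialSum x k

/-- The rearrangement of the increments `x` of a walk that lists those leading to a positive partial
sum, in reversed order, before those leading to a nonpositive one, in their original order. -/
noncomputable def rearrange : (n : ℕ) → (Fin n → ℝ) → Fin n → ℝ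
  | 0, x => x
  | n + 1, x =>
    if 0 < ∑ i, x i then Fin.cons (x (Fin.last n)) (rearrange n (Fin.init x))
    else Fin.snoc (rearrange n (Fin.init x)) (x (Fin.last n))

@[simp] lemma partialSum_zero {n : ℕ} (x : Fin n → ℝ) : partialSum x 0 = 0 := by
  simp [partialSum]

lemma partialSum_self {n : ℕ} (x : Fin n → ℝ) : partialSum x n = ∑ i, x i := by
  simp [partialSum]

lemma partialSum_cons_succ {n : ℕ} (a : ℝ) (y : Fin n → ℝ) (j : ℕ) :
    partialSum (Fin.cons a y : Fin (n + 1) → ℝ) (j + 1) = a + partialSum y j := by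
  simp [partialSum, Fin.sum_univ_succ]

lemma partialSum_snoc_of_le {n : ℕ} (a : ℝ) (y : Fin n → ℝ) {j : ℕ} (hj : j ≤ n) :
    partialSum (Fin.snoc y a : Fin (n + 1) → ℝ) j = partialSum y j := by
  simp [partialSum, Fin.sum_univ_castSucc, hj]

lemma partialSum_init {n : ℕ} (x : Fin (n + 1) → ℝ) {j : ℕ} (hj : j ≤ n) :
    partialSum (Fin.init x) j = partialSum x j := by
  conv_rhs => rw [← Fin.snoc_init_self x]
  rw [partialSum_snoc_of_le _ _ hj]

lemma partialSum_succ {n : ℕ} (x : Fin n → ℝ) {j : ℕ} (hj : j < n) :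
    partialSum x (j + 1) = partialSum x j + x ⟨j, hj⟩ := by
  have : x ⟨j, hj⟩ = ∑ i : Fin n, if i = ⟨j, hj⟩ then x i else 0 := by simp
  rw [this, partialSum, partialSum, ← Finset.sum_add_distrib]
  refine Finset.sum_congr rfl fun i _ => ?_
  by_cases h : i = ⟨j, hj⟩
  · simp [h]
  · have : (i : ℕ) ≠ j := fun h' => h (Fin.ext h')
    simp only [h, if_false, add_zero]
    congr 1
    apply propext
    omega

lemma partialSum_neg {n : ℕ} (x : Fin n → ℝ) (j : ℕ) : partialSum (-x) j = -partialSum x j := by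
  simp only [partialSum, ← Finset.sum_neg_distrib]
  refine Finset.sum_congr rfl fun i _ => ?_
  split_ifs <;> simp

@[fun_prop]
lemma measurable_partialSum {n : ℕ} (j : ℕ) :
    Measurable fun x : Fin n → ℝ => partialSum x j := by
  unfold partialSum
  refine Finset.measurable_sum _ fun i _ => ?_
  split_ifs <;> fun_prop

lemma posCount_le {n : ℕ} (x : Fin n → ℝ) : posCount x ≤ n :=
  (Finset.card_filter_le _ _).trans (by simp)

lemma measurable_posCount {n : ℕ} : Measurable (posCount : (Fin n → ℝ) → ℕ) := by
  have : (posCount : (Fin n → ℝ) → ℕ) =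
      fun x => ∑ j ∈ Finset.range n, if 0 < partialSum x (j + 1) then 1 else 0 := by
    ext x
    rw [posCount, Finset.card_filter]
  rw [this]
  refine Finset.measurable_sum _ fun j _ => Measurable.ite ?_ measurable_const measurable_const
  exact measurableSet_lt measurable_const (measurable_partialSum _)

lemma posCount_succ {n : ℕ} (x : Fin (n + 1) → ℝ) :
    posCount x = posCount (Fin.init x) + if 0 < ∑ i, x i then 1 else 0 := by
  simp only [posCount, Finset.card_filter, Finset.sum_range_succ, partialSum_self]
  congr 1
  refine Finset.sum_congr rfl fun j hj => ?_
  rw [partialSum_init x (Finset.mem_range.1 hj)]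

lemma sum_rearrange : ∀ (n : ℕ) (x : Fin n → ℝ), ∑ i, rearrange n x i = ∑ i, x i
  | 0, x => by simp
  | n + 1, x => by
    have h : ∑ i, x i = ∑ i, rearrange n (Fin.init x) i + x (Fin.last n) := by
      rw [sum_rearrange n, Fin.sum_univ_castSucc]
      rfl
    rw [rearrange]
    split_ifs
    · rw [Fin.sum_cons, h, add_comm]
    · rw [Fin.sum_snoc, h]

/-- A time at which the walk is first maximal is unique. -/
lemma IsFirstMaxAt.eq {n : ℕ} {x : Fin n → ℝ} {k l : ℕ} (hk : IsFirstMaxAt x k)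
    (hl : IsFirstMaxAt x l) : k = l := by
  rcases lt_trichotomy k l with h | h | h
  · exact absurd (hl.2.1 k h) (not_lt.2 (hk.2.2 l hl.1))
  · exact h
  · exact absurd (hk.2.1 l h) (not_lt.2 (hl.2.2 k hk.1))

/-- After the rearrangement, the number of positive partial sums becomes the first time of the
maximum. -/
lemma isFirstMaxAt_rearrange : ∀ (n : ℕ) (x : Fin n → ℝ),
    IsFirstMaxAt (rearrange n x) (posCount x)
  | 0, x => by simp [IsFirstMaxAt, posCount]
  | n + 1, x => by
    obtain ⟨h₁, h₂, h₃⟩ := isFirstMaxAt_rearrange n (Fin.init x)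
    have hsum : ∑ i, x i = x (Fin.last n) + partialSum (rearrange n (Fin.init x)) n := by
      rw [partialSum_self, sum_rearrange n, Fin.sum_univ_castSucc, add_comm]
      rfl
    rw [posCount_succ, rearrange]
    generalize rearrange n (Fin.init x) = y at *
    generalize posCount (Fin.init x) = k at *
    have hn := h₃ n le_rfl
    split_ifs with h
    · refine ⟨by omega, fun j hj => ?_, fun j hj => ?_⟩
      · rw [partialSum_cons_succ]
        cases j with
        | zero => rw [partialSum_zero]; linarith
        | succ j => rw [partialSum_cons_succ]; have := h₂ j (by omega); linarith
      · rw [partialSum_cons_succ]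
        cases j with
        | zero => rw [partialSum_zero]; linarith
        | succ j => rw [partialSum_cons_succ]; have := h₃ j (by omega); linarith
    · rw [add_zero]
      refine ⟨by omega, fun j hj => ?_, fun j hj => ?_⟩
      · rw [partialSum_snoc_of_le _ _ h₁, partialSum_snoc_of_le _ _ (by omega)]
        exact h₂ j hj
      · rw [partialSum_snoc_of_le _ _ h₁]
        rcases hj.lt_or_eq with hj | rfl
        · rw [partialSum_snoc_of_le _ _ (by omega)]
          exact h₃ j (by omega)
        · rw [partialSum_self, Fin.sum_snoc]
          have h0 := h₃ 0 (by omega)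
          rw [partialSum_zero] at h0
          rw [partialSum_self] at hsum
          linarith

/-! ### Invariance of the product measure under rearrangement -/

/-- Two measure preserving maps can be glued along the preimages of a set, provided that they pull
this set back to the same set. -/
lemma MeasureTheory.MeasurePreserving.piecewise_preimage {α β : Type*} [MeasurableSpace α]
    [MeasurableSpace β] {μ : Measure α} {ν : Measure β} {f g : α → β}
    (hf : MeasurePreserving f μ ν) (hg : MeasurePreserving g μ ν) {s : Set β}
    (hs : MeasurableSet s) (hfg : f ⁻¹' s = g ⁻¹' s) [DecidablePred (· ∈ f ⁻¹' s)] :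
    MeasurePreserving ((f ⁻¹' s).piecewise f g) μ ν := by
  have hm : Measurable ((f ⁻¹' s).piecewise f g) :=
    hf.measurable.piecewise (hf.measurable hs) hg.measurable
  refine ⟨hm, Measure.ext fun A hA => ?_⟩
  rw [Measure.map_apply hm hA, ← measure_inter_add_sdiff _ (hf.measurable hs)]
  have h₁ : (f ⁻¹' s).piecewise f g ⁻¹' A ∩ f ⁻¹' s = f ⁻¹' (A ∩ s) := by
    ext x
    by_cases hx : f x ∈ s <;> simp [Set.piecewise, hx]
  have h₂ : (f ⁻¹' s).piecewise f g ⁻¹' A \ f ⁻¹' s = g ⁻¹' (A \ s) := by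
    ext x
    have hx' : f x ∈ s ↔ g x ∈ s := Set.ext_iff.1 hfg x
    by_cases hx : f x ∈ s <;> simp [Set.piecewise, hx, hx'.symm]
  rw [h₁, h₂, hf.measure_preimage (hA.inter hs).nullMeasurableSet,
    hg.measure_preimage (hA.diff hs).nullMeasurableSet, measure_inter_add_sdiff _ hs]

section Pi

variable (μ : Measure ℝ) [IsProbabilityMeasure μ]

lemma measurePreserving_cons (n : ℕ) :
    MeasurePreserving (fun p : ℝ × (Fin n → ℝ) => (Fin.cons p.1 p.2 : Fin (n + 1) → ℝ))
      (μ.prod (Measure.pi fun _ => μ)) (Measure.pi fun _ => μ) := by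
  convert (measurePreserving_piFinSuccAbove (fun _ : Fin (n + 1) => μ) 0).symm using 1
  ext p i
  simp [MeasurableEquiv.piFinSuccAbove, Fin.insertNthEquiv]

lemma measurePreserving_snoc (n : ℕ) :
    MeasurePreserving (fun p : ℝ × (Fin n → ℝ) => (Fin.snoc p.2 p.1 : Fin (n + 1) → ℝ))
      (μ.prod (Measure.pi fun _ => μ)) (Measure.pi fun _ => μ) := by
  convert (measurePreserving_piFinSuccAbove (fun _ : Fin (n + 1) => μ) (Fin.last n)).symm using 1
  ext p i
  simp [MeasurableEquiv.piFinSuccAbove, Fin.insertNthEquiv]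

lemma measurePreserving_last_init (n : ℕ) :
    MeasurePreserving (fun x : Fin (n + 1) → ℝ => (x (Fin.last n), (Fin.init x : Fin n → ℝ)))
      (Measure.pi fun _ => μ) (μ.prod (Measure.pi fun _ => μ)) := by
  convert measurePreserving_piFinSuccAbove (fun _ : Fin (n + 1) => μ) (Fin.last n) using 1
  ext x i <;> simp [MeasurableEquiv.piFinSuccAbove, Fin.insertNthEquiv]

/-- The rearrangement preserves every power of `μ`. The last increment is put
before or after the rearranged previous ones, of which it is independent, and the choice depends
only on the sum of all increments, which the rearrangement does not change. -/
lemma measurePreserving_rearrange : ∀ n : ℕ,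
    MeasurePreserving (rearrange n) (Measure.pi fun _ => μ) (Measure.pi fun _ => μ)
  | 0 => by
    have : rearrange 0 = id := rfl
    rw [this]
    exact MeasurePreserving.id _
  | n + 1 => by
    classical
    have hp := ((MeasurePreserving.id μ).prod (measurePreserving_rearrange n)).comp
      (measurePreserving_last_init μ n)
    have hs : MeasurableSet {x : Fin (n + 1) → ℝ | 0 < ∑ i, x i} :=
      measurableSet_lt measurable_const (by fun_prop)
    have hg := (measurePreserving_cons μ n).piecewise_preimage (measurePreserving_snoc μ n) hs
      (by ext p; simp [Fin.sum_cons, Fin.sum_snoc, add_comm])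
    convert hg.comp hp using 1
    ext1 x
    have hsum : 0 < ∑ i, x i ↔ 0 < x (Fin.last n) + ∑ i, rearrange n (Fin.init x) i := by
      rw [sum_rearrange n, Fin.sum_univ_castSucc, add_comm]
      rfl
    simp only [Set.piecewise, Function.comp, Set.mem_preimage, Set.mem_ofPred_eq, Prod.map, id,
      Fin.sum_cons, rearrange, hsum]

lemma measure_posCount_eq (n k : ℕ) :
    (Measure.pi fun _ : Fin n => μ) {x | posCount x = k} =
      (Measure.pi fun _ : Fin n => μ) {x | IsFirstMaxAt x k} := by
  have h : {x : Fin n → ℝ | posCount x = k} = rearrange n ⁻¹' {x | IsFirstMaxAt x k} := by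
    ext x
    have hx := isFirstMaxAt_rearrange n x
    exact ⟨fun h => by rw [← h]; exact hx, fun h => hx.eq h⟩
  have hm : MeasurableSet {x : Fin n → ℝ | IsFirstMaxAt x k} := by
    simp only [IsFirstMaxAt, measurableSet_setOfPred]
    refine Measurable.and measurable_const (Measurable.and ?_ ?_) <;>
    refine Measurable.forall fun j => Measurable.imp measurable_const ?_
    · exact measurableSet_setOfPred.1 (measurableSet_lt (by fun_prop) (by fun_prop))
    · exact measurableSet_setOfPred.1 (measurableSet_le (by fun_prop) (by fun_prop))
  rw [h, (measurePreserving_rearrange μ n).measure_preimage hm.nullMeasurableSet]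

end Pi

/-! ### Splitting a random walk at its maximum -/

lemma measurableSet_forall_partialSum_pos (n : ℕ) :
    MeasurableSet {y : Fin n → ℝ | ∀ j < n, 0 < partialSum y (j + 1)} :=
  measurableSet_setOfPred.2 <| Measurable.forall fun _ => Measurable.imp measurable_const <|
    measurableSet_setOfPred.1 (measurableSet_lt measurable_const (by fun_prop))

lemma measurableSet_forall_partialSum_nonpos (n : ℕ) :
    MeasurableSet {y : Fin n → ℝ | ∀ j < n, partialSum y (j + 1) ≤ 0} :=
  measurableSet_setOfPred.2 <| Measurable.forall fun _ => Measurable.imp measurable_const <|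
    measurableSet_setOfPred.1 (measurableSet_le (by fun_prop) measurable_const)

/-- Reversing the first `k` entries of `x` reverses the walk up to time `k`. -/
lemma partialSum_rev_castAdd {k m : ℕ} (x : Fin (k + m) → ℝ) : ∀ {j : ℕ}, j ≤ k →
    partialSum (fun i : Fin k => x (Fin.castAdd m i.rev)) j = partialSum x k - partialSum x (k - j)
  | 0, _ => by simp
  | j + 1, hj => by
    have h : k - j = k - (j + 1) + 1 := by omega
    rw [partialSum_succ _ (by omega), partialSum_rev_castAdd x (by omega), h,
      partialSum_succ x (by omega)]
    have : Fin.castAdd m (Fin.rev ⟨j, hj⟩) = ⟨k - (j + 1), by omega⟩ := Fin.ext (by simp)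
    rw [this]
    ring

lemma partialSum_natAdd {k m : ℕ} (x : Fin (k + m) → ℝ) : ∀ {j : ℕ}, j ≤ m →
    partialSum (fun i : Fin m => x (Fin.natAdd k i)) j = partialSum x (k + j) - partialSum x k
  | 0, _ => by simp
  | j + 1, hj => by
    rw [partialSum_succ _ (by omega), partialSum_natAdd x (by omega), ← add_assoc,
      partialSum_succ x (by omega)]
    have : Fin.natAdd k (⟨j, hj⟩ : Fin m) = ⟨k + j, by omega⟩ := rfl
    rw [this]
    ring

/-- The walk is first maximal at time `k` iff, seen from time `k`, its past is negative and its
future is nonpositive. -/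
lemma isFirstMaxAt_iff {k m : ℕ} (x : Fin (k + m) → ℝ) :
    IsFirstMaxAt x k ↔
      (∀ j < k, 0 < partialSum (fun i : Fin k => x (Fin.castAdd m i.rev)) (j + 1)) ∧
        ∀ j < m, partialSum (fun i : Fin m => x (Fin.natAdd k i)) (j + 1) ≤ 0 := by
  constructor
  · rintro ⟨-, h₂, h₃⟩
    refine ⟨fun j hj => ?_, fun j hj => ?_⟩
    · rw [partialSum_rev_castAdd x (by omega), sub_pos]
      exact h₂ _ (by omega)
    · rw [partialSum_natAdd x (by omega), sub_nonpos]
      exact h₃ _ (by omega)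
  · rintro ⟨h₁, h₂⟩
    have h₂' : ∀ j < k, partialSum x j < partialSum x k := fun j hj => by
      have h := h₁ (k - j - 1) (by omega)
      have e : k - j - 1 + 1 = k - j := by omega
      have e' : k - (k - j) = j := by omega
      rwa [e, partialSum_rev_castAdd x (by omega), sub_pos, e'] at h
    refine ⟨by omega, h₂', fun j hj => ?_⟩
    rcases lt_trichotomy j k with hjk | rfl | hjk
    · exact (h₂' j hjk).le
    · exact le_rfl
    · obtain ⟨i, rfl⟩ : ∃ i, j = k + (i + 1) := ⟨j - k - 1, by omega⟩
      have h := h₂ i (by omega)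
      rwa [partialSum_natAdd x (by omega), sub_nonpos] at h

/-- The probability that a walk with independent increments of law `μ` stays positive during its
first `n` steps. -/
noncomputable def posProb (μ : Measure ℝ) (n : ℕ) : ℝ :=
  (Measure.pi fun _ : Fin n => μ).real {y | ∀ j < n, 0 < partialSum y (j + 1)}

section Pi

variable (μ : Measure ℝ) [IsProbabilityMeasure μ]

lemma posProb_zero : posProb μ 0 = 1 := by
  simp [posProb]

lemma measurePreserving_rev_natAdd (k m : ℕ) :
    MeasurePreserving (fun x : Fin (k + m) → ℝ =>
      ((fun i : Fin k => x (Fin.castAdd m i.rev)), fun i : Fin m => x (Fin.natAdd k i)))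
      (Measure.pi fun _ => μ) ((Measure.pi fun _ => μ).prod (Measure.pi fun _ => μ)) := by
  let e : Fin (k + m) ≃ Fin k ⊕ Fin m :=
    finSumFinEquiv.symm.trans (Equiv.sumCongr Fin.revPerm (Equiv.refl _))
  exact (measurePreserving_sumPiEquivProdPi fun _ : Fin k ⊕ Fin m => μ).comp
    (measurePreserving_arrowCongr' (fun _ => μ) (fun _ => μ) e (MeasurableEquiv.refl ℝ)
      fun _ => MeasurePreserving.id μ)

lemma ae_partialSum_ne_zero [NullSingletonClass μ] {n j : ℕ} (hj : j < n) :
    ∀ᵐ x ∂(Measure.pi fun _ : Fin n => μ), partialSum x (j + 1) ≠ 0 := by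
  obtain ⟨n, rfl⟩ : ∃ m, n = m + 1 := ⟨n - 1, by omega⟩
  -- By Fubini: for fixed later increments, a single value of the first one makes the sum vanish.
  have hm : MeasurableSet {x : Fin (n + 1) → ℝ | partialSum x (j + 1) = 0} :=
    measurableSet_eq_fun (by fun_prop) measurable_const
  rw [ae_iff]
  simp only [not_not]
  rw [← (measurePreserving_cons μ n).measure_preimage hm.nullMeasurableSet,
    ← (Measure.measurePreserving_swap (μ := Measure.pi fun _ : Fin n => μ) (ν := μ)).measure_preimage
      ((measurePreserving_cons μ n).measurable hm).nullMeasurableSet,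
    Measure.measure_prod_null (measurable_swap ((measurePreserving_cons μ n).measurable hm))]
  refine Filter.Eventually.of_forall fun y => ?_
  have : Prod.mk y ⁻¹' (Prod.swap ⁻¹' ((fun p : ℝ × (Fin n → ℝ) =>
      (Fin.cons p.1 p.2 : Fin (n + 1) → ℝ)) ⁻¹' {x | partialSum x (j + 1) = 0})) =
      {-partialSum y j} := by
    ext a
    simp [partialSum_cons_succ, eq_neg_iff_add_eq_zero]
  change μ _ = 0
  rw [this, measure_singleton]

/-- For a symmetric law without atoms, staying nonpositive is as likely as staying positive. -/
lemma measureReal_forall_partialSum_nonpos [NullSingletonClass μ] (hμ : μ.map (fun x => -x) = μ) (n : ℕ) :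
    (Measure.pi fun _ : Fin n => μ).real {z | ∀ j < n, partialSum z (j + 1) ≤ 0} = posProb μ n := by
  have hneg : MeasurePreserving (fun x : Fin n → ℝ => -x) (Measure.pi fun _ => μ)
      (Measure.pi fun _ => μ) :=
    measurePreserving_pi _ _ fun _ => ⟨measurable_neg, hμ⟩
  rw [posProb, ← hneg.measureReal_preimage
    (measurableSet_forall_partialSum_pos n).nullMeasurableSet]
  refine measureReal_congr ?_
  have h : ∀ᵐ x ∂(Measure.pi fun _ : Fin n => μ), ∀ j : ℕ, j < n → partialSum x (j + 1) ≠ 0 :=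
    ae_all_iff.2 fun j => by
      by_cases hj : j < n
      · filter_upwards [ae_partialSum_ne_zero μ hj] with x hx _ using hx
      · exact Filter.Eventually.of_forall fun x h => absurd h hj
  filter_upwards [h] with x hx
  apply propext
  refine forall₂_congr fun j hj => ?_
  rw [partialSum_neg, neg_pos]
  exact ⟨fun h => lt_of_le_of_ne h (hx j hj), le_of_lt⟩

/-- The number of positive partial sums is distributed as the first time of the maximum, at which
the walk splits into two independent pieces. -/
lemma measureReal_posCount_eq [NullSingletonClass μ] (hμ : μ.map (fun x => -x) = μ) {n k : ℕ} (hk : k ≤ n) :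
    (Measure.pi fun _ : Fin n => μ).real {x | posCount x = k} = posProb μ k * posProb μ (n - k) := by
  obtain ⟨m, rfl⟩ := Nat.exists_eq_add_of_le hk
  have h : {x : Fin (k + m) → ℝ | IsFirstMaxAt x k} = (fun x : Fin (k + m) → ℝ =>
      ((fun i : Fin k => x (Fin.castAdd m i.rev)), fun i : Fin m => x (Fin.natAdd k i))) ⁻¹'
      ({y | ∀ j < k, 0 < partialSum y (j + 1)} ×ˢ {z | ∀ j < m, partialSum z (j + 1) ≤ 0}) := by
    ext x
    exact isFirstMaxAt_iff x
  rw [measureReal_def, measure_posCount_eq, ← measureReal_def, h,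
    (measurePreserving_rev_natAdd μ k m).measureReal_preimage
      ((measurableSet_forall_partialSum_pos k).prod
        (measurableSet_forall_partialSum_nonpos m)).nullMeasurableSet,
    measureReal_prod_prod, measureReal_forall_partialSum_nonpos μ hμ, Nat.add_sub_cancel_left]
  rfl

lemma sum_posProb_mul_posProb [NullSingletonClass μ] (hμ : μ.map (fun x => -x) = μ) (n : ℕ) :
    ∑ k ∈ Finset.range (n + 1), posProb μ k * posProb μ (n - k) = 1 := by
  have h : (posCount ⁻¹' (Finset.range (n + 1) : Finset ℕ) : Set (Fin n → ℝ)) = Set.univ := by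
    ext x
    simpa [Nat.lt_succ_iff] using posCount_le x
  rw [← probReal_univ (μ := Measure.pi fun _ : Fin n => μ), ← h,
    ← sum_measureReal_preimage_singleton _ fun k _ => measurable_posCount (measurableSet_singleton k)]
  refine Finset.sum_congr rfl fun k hk => ?_
  exact (measureReal_posCount_eq μ hμ (Nat.lt_succ_iff.1 (Finset.mem_range.1 hk))).symm

end Pi

/-- A sequence starting at `1` is determined by its self-convolution. -/
lemma eq_of_sum_mul_eq {u w : ℕ → ℝ} (hu : u 0 = 1) (hw : w 0 = 1)
    (h : ∀ n, ∑ k ∈ Finset.range (n + 1), u k * u (n - k) =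
      ∑ k ∈ Finset.range (n + 1), w k * w (n - k)) (n : ℕ) : u n = w n := by
  induction n using Nat.strong_induction_on with
  | _ n ih =>
    cases n with
    | zero => rw [hu, hw]
    | succ n =>
      have hn := h (n + 1)
      have e (f : ℕ → ℝ) : ∑ k ∈ Finset.range (n + 1 + 1), f k * f (n + 1 - k) =
          ∑ k ∈ Finset.range n, f (k + 1) * f (n + 1 - (k + 1)) + f (n + 1) * f 0 +
            f 0 * f (n + 1) := by
        rw [Finset.sum_range_succ', Finset.sum_range_succ, Nat.sub_self, Nat.sub_zero]
      have hmid : ∑ k ∈ Finset.range n, u (k + 1) * u (n + 1 - (k + 1)) =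
          ∑ k ∈ Finset.range n, w (k + 1) * w (n + 1 - (k + 1)) := by
        refine Finset.sum_congr rfl fun k hk => ?_
        have hk := Finset.mem_range.1 hk
        rw [ih (k + 1) (by omega), ih (n + 1 - (k + 1)) (by omega)]
      rw [e, e, hmid, hu, hw] at hn
      linarith

/-! ### Beta integrals and the discrete arcsine law -/

/-- The density of the arcsine law is that of the beta law with both parameters `1 / 2`. -/
lemma arcsineMeasure_eq_betaMeasure : arcsineMeasure = betaMeasure (1 / 2) (1 / 2) := by
  unfold arcsineMeasure betaMeasure
  congr 1
  ext x
  rw [betaPDF, betaPDFReal, arcsinePDFReal]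
  congr 1
  by_cases hx : 0 < x ∧ x < 1
  · have h0 := hx.1
    have h1 : 0 < 1 - x := by linarith [hx.2]
    have hb : beta (1 / 2) (1 / 2) = Real.pi := by
      rw [beta, Real.Gamma_one_half_eq]
      norm_num
      exact Real.mul_self_sqrt Real.pi_pos.le
    rw [if_pos hx, Set.indicator_of_mem (show x ∈ Set.Ioo (0 : ℝ) 1 from hx), hb,
      show (1 / 2 - 1 : ℝ) = -(1 / 2) by norm_num, Real.rpow_neg h0.le, Real.rpow_neg h1.le,
      ← Real.sqrt_eq_rpow, ← Real.sqrt_eq_rpow, Real.sqrt_mul h0.le]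
    field_simp
  · rw [if_neg hx, Set.indicator_of_notMem (show x ∉ Set.Ioo (0 : ℝ) 1 from hx)]

instance : IsProbabilityMeasure arcsineMeasure := by
  rw [arcsineMeasure_eq_betaMeasure]
  exact isProbabilityMeasureBeta (by norm_num) (by norm_num)

lemma ae_arcsineMeasure_mem_Ioo : ∀ᵐ x ∂arcsineMeasure, x ∈ Set.Ioo (0 : ℝ) 1 := by
  have hm : Measurable (betaPDF (1 / 2) (1 / 2)) := (measurable_betaPDFReal _ _).ennreal_ofReal
  rw [arcsineMeasure_eq_betaMeasure, betaMeasure, ae_withDensity_iff hm]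
  refine Filter.Eventually.of_forall fun x hx => ?_
  by_contra h
  rw [Set.mem_Ioo] at h
  refine hx ?_
  rw [betaPDF, betaPDFReal, if_neg h, ENNReal.ofReal_zero]

/-- The sequence `Γ(n + 1/2) / (√π n!)`, that is, `(2n choose n) / 4 ^ n`. -/
noncomputable def arcsineWeight (n : ℕ) : ℝ :=
  Real.Gamma (n + 1 / 2) / (√Real.pi * n.factorial)

lemma arcsineWeight_zero : arcsineWeight 0 = 1 := by
  have : √Real.pi ≠ 0 := (Real.sqrt_pos.2 Real.pi_pos).ne'
  rw [arcsineWeight, Nat.cast_zero, zero_add, Real.Gamma_one_half_eq]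
  simp [this]

/-- A binomial law whose success probability has the arcsine law is the discrete arcsine law. -/
lemma integral_choose_mul_arcsineMeasure {n k : ℕ} (hk : k ≤ n) :
    ∫ x, (n.choose k : ℝ) * x ^ k * (1 - x) ^ (n - k) ∂arcsineMeasure =
      arcsineWeight k * arcsineWeight (n - k) := by
  obtain ⟨m, rfl⟩ := Nat.exists_eq_add_of_le hk
  rw [Nat.add_sub_cancel_left]
  have hα : (0 : ℝ) < k + 1 / 2 := by positivity
  have hβ : (0 : ℝ) < m + 1 / 2 := by positivity
  have hb := beta_pos hα hβ
  have hb' : 0 < beta (1 / 2) (1 / 2) := beta_pos (by norm_num) (by norm_num)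
  set c : ℝ := (k + m).choose k * (beta (k + 1 / 2) (m + 1 / 2) / beta (1 / 2) (1 / 2)) with hc
  have hpt (x : ℝ) : betaPDFReal (1 / 2) (1 / 2) x * (((k + m).choose k : ℝ) * x ^ k * (1 - x) ^ m) =
      c * betaPDFReal (k + 1 / 2) (m + 1 / 2) x := by
    rw [betaPDFReal, betaPDFReal]
    split_ifs with hx
    · have h0 := hx.1
      have h1 : 0 < 1 - x := by linarith [hx.2]
      rw [show (k + 1 / 2 - 1 : ℝ) = k + (1 / 2 - 1) by ring,
        show (m + 1 / 2 - 1 : ℝ) = m + (1 / 2 - 1) by ring, Real.rpow_add h0, Real.rpow_add h1,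
        Real.rpow_natCast, Real.rpow_natCast, hc]
      have hb₀ := hb.ne'
      have hb₀' := hb'.ne'
      generalize beta (k + 1 / 2) (m + 1 / 2) = b at hb₀ ⊢
      generalize beta (1 / 2) (1 / 2) = b' at hb₀' ⊢
      field_simp
    · simp
  have hnn {α β : ℝ} (h : 0 < α) (h' : 0 < β) (x : ℝ) : 0 ≤ betaPDFReal α β x := by
    by_cases hx : 0 < x ∧ x < 1
    · exact (betaPDFReal_pos hx.1 hx.2 h h').le
    · rw [betaPDFReal, if_neg hx]
  have hone : ∫ x, betaPDFReal (k + 1 / 2) (m + 1 / 2) x = 1 := by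
    rw [integral_eq_lintegral_of_nonneg_ae (Filter.Eventually.of_forall (hnn hα hβ))
      (measurable_betaPDFReal _ _).aestronglyMeasurable]
    have := lintegral_betaPDF_eq_one hα hβ
    simp only [betaPDF] at this
    rw [this, ENNReal.toReal_one]
  rw [arcsineMeasure_eq_betaMeasure, betaMeasure]
  unfold betaPDF
  rw [integral_withDensity_eq_integral_toReal_smul
    (measurable_betaPDFReal _ _).ennreal_ofReal (by simp)]
  simp only [smul_eq_mul, ENNReal.toReal_ofReal (hnn one_half_pos one_half_pos _), hpt]
  rw [integral_const_mul, hone, mul_one, hc, arcsineWeight, arcsineWeight, beta, beta,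
    Real.Gamma_one_half_eq, show (1 / 2 + 1 / 2 : ℝ) = 1 by norm_num, Real.Gamma_one,
    show (k + 1 / 2 + (m + 1 / 2) : ℝ) = ((k + m : ℕ) : ℝ) + 1 by push_cast; ring,
    Real.Gamma_nat_eq_factorial, Nat.choose_symm_add, Nat.add_choose, Nat.cast_div
      (Nat.factorial_mul_factorial_dvd_factorial_add k m) (by positivity)]
  push_cast
  field_simp

lemma choose_mul_pow_nonneg (n k : ℕ) {x : ℝ} (hx : x ∈ Set.Ioo (0 : ℝ) 1) :
    0 ≤ (n.choose k : ℝ) * x ^ k * (1 - x) ^ (n - k) := by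
  have h0 := hx.1.le
  have h1 : 0 ≤ 1 - x := by linarith [hx.2]
  positivity

lemma sum_choose_mul_pow (n : ℕ) (x : ℝ) :
    ∑ k ∈ Finset.range (n + 1), (n.choose k : ℝ) * x ^ k * (1 - x) ^ (n - k) = 1 := by
  calc ∑ k ∈ Finset.range (n + 1), (n.choose k : ℝ) * x ^ k * (1 - x) ^ (n - k)
      = (x + (1 - x)) ^ n := by
        rw [add_pow]
        exact Finset.sum_congr rfl fun k _ => by ring
    _ = 1 := by simp

lemma integrable_choose_mul_pow (n k : ℕ) : Integrable
    (fun x : ℝ => (n.choose k : ℝ) * x ^ k * (1 - x) ^ (n - k)) arcsineMeasure := by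
  refine Integrable.of_bound (Measurable.aestronglyMeasurable (by fun_prop)) 1 ?_
  filter_upwards [ae_arcsineMeasure_mem_Ioo] with x hx
  rw [Real.norm_of_nonneg (choose_mul_pow_nonneg n k hx)]
  by_cases hk : k ∈ Finset.range (n + 1)
  · exact (Finset.single_le_sum (f := fun k => (n.choose k : ℝ) * x ^ k * (1 - x) ^ (n - k))
      (fun i _ => choose_mul_pow_nonneg n i hx) hk).trans_eq (sum_choose_mul_pow n x)
  · rw [Nat.choose_eq_zero_of_lt (by simpa using hk)]
    simp

lemma sum_arcsineWeight_mul_arcsineWeight (n : ℕ) :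
    ∑ k ∈ Finset.range (n + 1), arcsineWeight k * arcsineWeight (n - k) = 1 := by
  calc ∑ k ∈ Finset.range (n + 1), arcsineWeight k * arcsineWeight (n - k)
      = ∑ k ∈ Finset.range (n + 1),
          ∫ x, (n.choose k : ℝ) * x ^ k * (1 - x) ^ (n - k) ∂arcsineMeasure :=
        Finset.sum_congr rfl fun k hk => (integral_choose_mul_arcsineMeasure
          (Nat.lt_succ_iff.1 (Finset.mem_range.1 hk))).symm
    _ = 1 := by
        rw [← integral_finsetSum _ fun k _ => integrable_choose_mul_pow n k]
        simp [sum_choose_mul_pow]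

/-- The number of positive partial sums of a walk with symmetric increments without atoms is a
binomial variable with arcsine distributed success probability. -/
lemma measureReal_posCount_eq_integral (μ : Measure ℝ) [IsProbabilityMeasure μ] [NullSingletonClass μ]
    (hμ : μ.map (fun x => -x) = μ) {n k : ℕ} (hk : k ≤ n) :
    (Measure.pi fun _ : Fin n => μ).real {x | posCount x = k} =
      ∫ x, (n.choose k : ℝ) * x ^ k * (1 - x) ^ (n - k) ∂arcsineMeasure := by
  have h := eq_of_sum_mul_eq (posProb_zero μ) arcsineWeight_zero fun n => by
    rw [sum_posProb_mul_posProb μ hμ, sum_arcsineWeight_mul_arcsineWeight]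
  rw [measureReal_posCount_eq μ hμ hk, integral_choose_mul_arcsineMeasure hk, h, h]

open Filter Topology

/-! ### Convergence of the discrete arcsine laws -/

lemma integral_comp_posCount (μ : Measure ℝ) [IsProbabilityMeasure μ] (n : ℕ) (f : ℕ → ℝ) :
    ∫ x, f (posCount x) ∂(Measure.pi fun _ : Fin n => μ) =
      ∑ k ∈ Finset.range (n + 1), (Measure.pi fun _ : Fin n => μ).real {x | posCount x = k} * f k := by
  have hm (k : ℕ) : MeasurableSet {x : Fin n → ℝ | posCount x = k} :=
    measurable_posCount (measurableSet_singleton k)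
  have h (x : Fin n → ℝ) : f (posCount x) =
      ∑ k ∈ Finset.range (n + 1), {x : Fin n → ℝ | posCount x = k}.indicator (fun _ => f k) x := by
    rw [Finset.sum_eq_single_of_mem (posCount x)
      (Finset.mem_range.2 (Nat.lt_succ_of_le (posCount_le x)))]
    · simp
    · intro k _ hk
      simp [hk.symm]
  simp only [h]
  rw [integral_finsetSum _ fun k _ => (integrable_const _).indicator (hm k)]
  refine Finset.sum_congr rfl fun k _ => ?_
  rw [integral_indicator_const _ (hm k), smul_eq_mul]

/-- The proportion of positive partial sums of symmetric random walks without atoms converges in law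
to the arcsine distribution. By `measureReal_posCount_eq_integral`, its expectation against `f` is
the arcsine integral of a Bernstein polynomial of `f`. -/
lemma tendsto_integral_posCount_div (μ : ℕ → Measure ℝ) [∀ n, IsProbabilityMeasure (μ n)]
    (hat : ∀ᶠ n in atTop, NullSingletonClass (μ n)) (hμ : ∀ n, (μ n).map (fun x => -x) = μ n)
    (f : BoundedContinuousFunction ℝ ℝ) :
    Tendsto (fun n : ℕ => ∫ x, f (posCount x / n) ∂(Measure.pi fun _ : Fin n => μ n)) atTop
      (𝓝 (∫ x, f x ∂arcsineMeasure)) := by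
  set g : ℕ → ℝ → ℝ := fun n x => ∑ k ∈ Finset.range (n + 1),
    (n.choose k : ℝ) * x ^ k * (1 - x) ^ (n - k) * f (k / n) with hg
  have hlim : Tendsto (fun n => ∫ x, g n x ∂arcsineMeasure) atTop
      (𝓝 (∫ x, f x ∂arcsineMeasure)) := by
    refine tendsto_integral_of_dominated_convergence (fun _ => ‖f‖)
      (fun n => Measurable.aestronglyMeasurable (by fun_prop)) (integrable_const _) (fun n => ?_) ?_
    · filter_upwards [ae_arcsineMeasure_mem_Ioo] with x hx
      calc ‖g n x‖ ≤ ∑ k ∈ Finset.range (n + 1),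
            (n.choose k : ℝ) * x ^ k * (1 - x) ^ (n - k) * ‖f‖ := by
            refine norm_sum_le_of_le _ fun k _ => ?_
            rw [norm_mul, Real.norm_of_nonneg (choose_mul_pow_nonneg n k hx)]
            exact mul_le_mul_of_nonneg_left (f.norm_coe_le_norm _) (choose_mul_pow_nonneg n k hx)
        _ = ‖f‖ := by rw [← Finset.sum_mul, sum_choose_mul_pow, one_mul]
    · filter_upwards [ae_arcsineMeasure_mem_Ioo] with x hx
      let F : C(unitInterval, ℝ) := ⟨fun y => f y, by fun_prop⟩
      have h := ((continuous_eval_const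
        (⟨x, hx.1.le, hx.2.le⟩ : unitInterval)).tendsto F).comp (bernsteinApproximation_uniform F)
      refine h.congr fun n => ?_
      rw [Function.comp, bernsteinApproximation.apply, hg]
      simp only [Finset.sum_range, bernstein_apply, smul_eq_mul]
      rfl
  refine hlim.congr' ?_
  filter_upwards [hat] with n hn
  rw [integral_comp_posCount (μ n) n fun k => f (k / n), hg]
  simp only
  rw [integral_finsetSum _ fun k _ => (integrable_choose_mul_pow n k).mul_const _]
  refine Finset.sum_congr rfl fun k hk => ?_
  rw [integral_mul_const, measureReal_posCount_eq_integral (μ n) (hμ n)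
    (Nat.lt_succ_iff.1 (Finset.mem_range.1 hk))]

/-! ### Riemann sums of the indicator of positivity -/

/-- Riemann sums of the indicator of `{c > 0}` converge when `c` is continuous and its zero set is
negligible, since the indicator is then continuous almost everywhere. -/
lemma tendsto_card_pos_div {c : ℝ → ℝ} (hc : Continuous c)
    (h0 : ∀ᵐ s : ℝ, s ∈ Set.Ioc (0 : ℝ) 1 → c s ≠ 0) :
    Tendsto (fun n : ℕ => (((Finset.range n).filter
      fun j : ℕ => 0 < c (((j + 1 : ℕ) : ℝ) / n)).card : ℝ) / n) atTop
      (𝓝 (∫ s in (0 : ℝ)..1, (Set.Ioi (0 : ℝ)).indicator (fun _ => (1 : ℝ)) (c s))) := by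
  set h : ℝ → ℝ := (Set.Ioi (0 : ℝ)).indicator (fun _ => (1 : ℝ)) with hh
  have hm : Measurable h := measurable_const.indicator measurableSet_Ioi
  have hstep (n : ℕ) (hn : n ≠ 0) : (((Finset.range n).filter
      fun j : ℕ => 0 < c (((j + 1 : ℕ) : ℝ) / n)).card : ℝ) / n =
      ∫ s in (0 : ℝ)..1, h (c ((⌈s * n⌉₊ : ℝ) / n)) := by
    have hn' : (0 : ℝ) < n := by positivity
    -- The Riemann sum is the integral of a step function, constant on each `(j / n, (j + 1) / n]`.
    have hcongr (j : ℕ) : Set.EqOn (fun s : ℝ => h (c ((⌈s * n⌉₊ : ℝ) / n)))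
        (fun _ => h (c (((j + 1 : ℕ) : ℝ) / n)))
        (Set.uIoc ((j : ℝ) / n) (((j + 1 : ℕ) : ℝ) / n)) := by
      intro s hs
      rw [Set.uIoc_of_le (by gcongr; simp)] at hs
      have : ⌈s * n⌉₊ = j + 1 := by
        rw [Nat.ceil_eq_iff (by omega), Nat.add_sub_cancel]
        exact ⟨(div_lt_iff₀ hn').1 hs.1, (le_div_iff₀ hn').1 hs.2⟩
      simp only [this]
    have hint (j : ℕ) : IntervalIntegrable (fun s : ℝ => h (c ((⌈s * n⌉₊ : ℝ) / n))) volume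
        ((j : ℝ) / n) (((j + 1 : ℕ) : ℝ) / n) :=
      (intervalIntegrable_const (c := h (c (((j + 1 : ℕ) : ℝ) / n)))).congr
        (hcongr j).symm
    have hadj := intervalIntegral.sum_integral_adjacent_intervals
      (a := fun j : ℕ => (j : ℝ) / n) (n := n) fun j _ => hint j
    rw [Nat.cast_zero, zero_div, div_self hn'.ne'] at hadj
    rw [← hadj, Finset.card_filter, Nat.cast_sum, Finset.sum_div]
    refine Finset.sum_congr rfl fun j _ => ?_
    rw [intervalIntegral.integral_congr_ae (Eventually.of_forall (hcongr j)), intervalIntegral.integral_const,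
      smul_eq_mul, hh, Set.indicator_apply]
    simp only [Set.mem_Ioi]
    split_ifs
    · push_cast
      field_simp
      ring
    · simp
  refine Tendsto.congr' ((eventually_ne_atTop 0).mono fun n hn => (hstep n hn).symm) ?_
  refine intervalIntegral.tendsto_integral_filter_of_dominated_convergence (fun _ => 1)
    (Eventually.of_forall fun n => ?_) (Eventually.of_forall fun n => ?_)
    intervalIntegrable_const ?_
  · exact (hm.comp (hc.measurable.comp ((measurable_from_nat.comp
      (Nat.measurable_ceil.comp (measurable_id.mul_const _))).div_const _))).aestronglyMeasurable
  · refine Eventually.of_forall fun s _ => ?_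
    rw [hh, Set.indicator_apply]
    split_ifs <;> simp
  · filter_upwards [h0] with s hs hs'
    rw [Set.uIoc_of_le zero_le_one] at hs'
    have hcs := hs hs'
    have hlim : Tendsto (fun n : ℕ => c ((⌈s * n⌉₊ : ℝ) / n)) atTop (𝓝 (c s)) :=
      (hc.tendsto s).comp
        ((tendsto_nat_ceil_mul_div_atTop hs'.1.le).comp tendsto_natCast_atTop_atTop)
    refine Tendsto.comp (g := h) ?_ hlim
    rcases hcs.lt_or_gt with hneg | hpos
    · refine tendsto_const_nhds.congr' ?_
      filter_upwards [Iio_mem_nhds hneg] with y hy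
      rw [hh, Set.indicator_of_notMem (by simpa using hneg.le),
        Set.indicator_of_notMem (by simpa using (Set.mem_Iio.1 hy).le)]
    · refine tendsto_const_nhds.congr' ?_
      filter_upwards [Ioi_mem_nhds hpos] with y hy
      rw [hh, Set.indicator_of_mem (by simpa using hpos),
        Set.indicator_of_mem (by simpa using hy)]

/-! ### The zero set and the increments of Brownian motion -/

section Brownian

variable {Ω : Type*} {mΩ : MeasurableSpace Ω} {P : Measure Ω} {B : ℝ≥0 → Ω → ℝ}

/-- Off a null set, a process with continuous paths coincides with a jointly measurable one. -/
lemma exists_jointly_measurable_of_continuous (hm : ∀ s, AEMeasurable (B s) P)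
    (hc : ∀ᵐ ω ∂P, Continuous (B · ω)) :
    ∃ C : ℝ≥0 → Ω → ℝ, Measurable (Function.uncurry C) ∧ ∀ᵐ ω ∂P, ∀ s, C s ω = B s ω := by
  classical
  -- On a measurable set of full measure the paths are continuous and their values at rational
  -- times are measurable. They are replaced by `0` elsewhere.
  let q : ℕ → ℕ → ℝ≥0 := fun n k => (k : ℝ≥0) / n
  have hgood : ∀ᵐ ω ∂P, Continuous (B · ω) ∧ ∀ n k, B (q n k) ω = (hm (q n k)).mk _ ω :=
    hc.and (ae_all_iff.2 fun n => ae_all_iff.2 fun k => (hm (q n k)).ae_eq_mk)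
  obtain ⟨S, hS, hSm, hSg⟩ := hgood.exists_measurable_mem
  let C : ℝ≥0 → Ω → ℝ := fun s => S.indicator (B s)
  have hq (n k : ℕ) : Measurable (C (q n k)) := by
    have : C (q n k) = S.indicator ((hm (q n k)).mk _) :=
      Set.indicator_congr fun ω hω => (hSg ω hω).2 n k
    rw [this]
    exact (hm _).measurable_mk.indicator hSm
  have hcont (ω : Ω) : Continuous fun s => C s ω := by
    by_cases hω : ω ∈ S
    · simpa [C, hω] using (hSg ω hω).1
    · simp only [C, Set.indicator_of_notMem hω]
      exact continuous_const
  refine ⟨C, measurable_uncurry_of_continuous_of_measurable hcont fun s => ?_, ?_⟩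
  · refine measurable_of_tendsto_metrizable (fun n => hq n ⌈(s : ℝ) * n⌉₊)
      (tendsto_pi_nhds.2 fun ω => ((hcont ω).tendsto s).comp ?_)
    refine NNReal.tendsto_coe.1 ?_
    simp only [q, NNReal.coe_div, NNReal.coe_natCast]
    exact (tendsto_nat_ceil_mul_div_atTop s.2).comp tendsto_natCast_atTop_atTop
  · filter_upwards [hS] with ω hω s using by simp [C, hω]

/-- Almost surely, the zero set of Brownian motion is negligible. -/
lemma ProbabilityTheory.IsBrownianReal.ae_ae_ne_zero [SFinite P] (hB : IsBrownianReal B P) :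
    ∀ᵐ ω ∂P, ∀ᵐ s : ℝ, 0 < s → B s.toNNReal ω ≠ 0 := by
  obtain ⟨C, hC, hCB⟩ := exists_jointly_measurable_of_continuous hB.aemeasurable hB.cont
  have hne : ∀ᵐ s : ℝ, ∀ᵐ ω ∂P, 0 < s → C s.toNNReal ω ≠ 0 := by
    refine Eventually.of_forall fun s => ?_
    by_cases hs : 0 < s
    · have := nullSingletonClass_gaussianReal (μ := 0) (Real.toNNReal_pos.2 hs).ne'
      have h : ∀ᵐ x ∂(gaussianReal 0 s.toNNReal), x ≠ 0 := Measure.ae_ne _ 0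
      have h' := ((hB.hasLaw_eval s.toNNReal).ae_iff (measurableSet_setOfPred.1
        (measurableSet_singleton (0 : ℝ)).compl)).2 h
      filter_upwards [h', hCB] with ω h1 h2 _
      rw [h2]
      exact h1
    · exact Eventually.of_forall fun ω h => absurd h hs
  have hmeas : MeasurableSet {p : ℝ × Ω | 0 < p.1 → C p.1.toNNReal p.2 ≠ 0} := by
    have h : Measurable fun p : ℝ × Ω => C p.1.toNNReal p.2 :=
      hC.comp ((measurable_real_toNNReal.comp measurable_fst).prodMk measurable_snd)
    exact measurableSet_setOfPred.2 (Measurable.imp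
      (measurableSet_setOfPred.1 (measurableSet_lt measurable_const measurable_fst))
      (measurableSet_setOfPred.1 (h (measurableSet_singleton 0).compl)))
  filter_upwards [(Measure.ae_ae_comm hmeas).1 hne, hCB] with ω h1 h2
  filter_upwards [h1] with s hs h
  rw [← h2]
  exact hs h

/-- The increments of Brownian motion over a regular subdivision of `[0, t]` are independent and
identically distributed. -/
lemma ProbabilityTheory.IsPreBrownianReal.hasLaw_regular_increments [IsProbabilityMeasure P]
    (hB : IsPreBrownianReal B P) (t : ℝ≥0) (n : ℕ) :
    HasLaw (fun ω (i : Fin n) => B (t * ((i + 1 : ℕ) : ℝ≥0) / n) ω - B (t * (i : ℕ) / n) ω)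
      (Measure.pi fun _ => gaussianReal 0 (t / n)) P := by
  have hmono : Monotone fun i : Fin (n + 1) => t * (i : ℕ) / (n : ℝ≥0) := fun i j hij => by
    have : (i : ℕ) ≤ j := hij
    dsimp only
    gcongr
  refine iIndepFun.hasLaw_pi (fun i => ?_) (hB.hasIndepIncrements n _ hmono)
  have h := hB.hasLaw_sub (t * ((i + 1 : ℕ) : ℝ≥0) / n) (t * (i : ℕ) / n)
  have hv : nndist (t * ((i + 1 : ℕ) : ℝ≥0) / n : ℝ≥0).1 (t * (i : ℕ) / n : ℝ≥0).1 = t / n := by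
    ext
    rw [coe_nndist, Real.dist_eq]
    have : (t * ((i + 1 : ℕ) : ℝ≥0) / n : ℝ≥0).1 - (t * (i : ℕ) / n : ℝ≥0).1 = (t / n : ℝ≥0) := by
      simp only [NNReal.val_eq_coe]
      push_cast
      ring
    rw [this, abs_of_nonneg (NNReal.coe_nonneg _)]
  rwa [hv] at h

lemma posCount_increments (b : ℕ → ℝ) (h0 : b 0 = 0) (n : ℕ) :
    posCount (fun i : Fin n => b (i + 1) - b i) =
      ((Finset.range n).filter fun j => 0 < b (j + 1)).card := by
  have h : ∀ j ≤ n, partialSum (fun i : Fin n => b (i + 1) - b i) j = b j := by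
    intro j
    induction j with
    | zero => simp [h0]
    | succ j ih =>
      intro hj
      rw [partialSum_succ _ hj, ih (by omega)]
      ring
  rw [posCount]
  congr 1
  refine Finset.filter_congr fun j hj => ?_
  rw [h _ (Finset.mem_range.1 hj)]

/-- The proportion of points of a regular subdivision of `[0, t]` at which Brownian motion is
positive converges almost surely to the proportion of time that it spends above zero. -/
lemma ProbabilityTheory.IsBrownianReal.ae_tendsto_posCount_div [SFinite P]
    (hB : IsBrownianReal B P) {t : ℝ≥0} (ht : 0 < t) :
    ∀ᵐ ω ∂P, Tendsto (fun n : ℕ => (posCount (fun i : Fin n =>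
      B (t * ((i + 1 : ℕ) : ℝ≥0) / n) ω - B (t * (i : ℕ) / n) ω) : ℝ) / n) atTop
      (𝓝 (occupationProportion B t ω)) := by
  filter_upwards [hB.cont, hB.eval_zero_ae_eq_zero, hB.ae_ae_ne_zero] with ω hc h0 hne
  have hne' : ∀ᵐ s : ℝ, s ∈ Set.Ioc (0 : ℝ) 1 → B (t * s).toNNReal ω ≠ 0 := by
    have hq := (Measure.quasiMeasurePreserving_smul (volume : Measure ℝ)
      (r := (t : ℝ)) (by positivity)).ae hne
    filter_upwards [hq] with s hs h
    exact hs (mul_pos (by exact_mod_cast ht) h.1)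
  have hlim := tendsto_card_pos_div (c := fun s => B (t * s).toNNReal ω)
    (hc.comp (by fun_prop)) hne'
  have hocc : occupationProportion B t ω = ∫ s in (0 : ℝ)..1,
      (Set.Ioi (0 : ℝ)).indicator (fun _ => (1 : ℝ)) (B (t * s).toNNReal ω) := by
    rw [occupationProportion, intervalIntegral.integral_comp_mul_left
      (fun s => (Set.Ioi (0 : ℝ)).indicator (fun _ => (1 : ℝ)) (B s.toNNReal ω))
      (by positivity), mul_zero, mul_one, smul_eq_mul]
  rw [hocc]
  refine hlim.congr fun n => ?_
  rw [posCount_increments (fun j => B (t * (j : ℕ) / n) ω) (by simpa using h0)]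
  have (j : ℕ) : ((t : ℝ) * (((j + 1 : ℕ) : ℝ) / n)).toNNReal = t * ((j + 1 : ℕ) : ℝ≥0) / n := by
    rw [← mul_div_assoc]
    exact Real.toNNReal_coe (r := t * ((j + 1 : ℕ) : ℝ≥0) / n)
  simp only [this]

end Brownian

theorem theorem1 {Ω : Type*} [MeasurableSpace Ω] (P : Measure Ω) [IsProbabilityMeasure P]
    (B : ℝ≥0 → Ω → ℝ) (hB : IsBrownianReal B P) (t : ℝ) (ht : 0 < t) :
    HasLaw (occupationProportion B t) arcsineMeasure P := by
  lift t to ℝ≥0 using ht.le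
  have ht : 0 < t := by exact_mod_cast ht
  let X : (n : ℕ) → Ω → Fin n → ℝ := fun n ω i =>
    B (t * ((i + 1 : ℕ) : ℝ≥0) / n) ω - B (t * (i : ℕ) / n) ω
  have hX (n : ℕ) := hB.hasLaw_regular_increments t n
  have hlim := hB.ae_tendsto_posCount_div ht
  have hmeas (n : ℕ) : AEMeasurable (fun ω => (posCount (X n ω) : ℝ) / n) P :=
    ((measurable_from_nat.comp measurable_posCount).comp_aemeasurable (hX n).aemeasurable).div_const _
  have hocc : AEMeasurable (occupationProportion B t) P :=
    aemeasurable_of_tendsto_metrizable_ae atTop hmeas hlim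
  refine ⟨hocc, ?_⟩
  have := Measure.isProbabilityMeasure_map (μ := P) hocc
  refine ext_of_forall_integral_eq_of_IsFiniteMeasure fun f => ?_
  rw [integral_map hocc f.continuous.aestronglyMeasurable]
  have h₁ : Tendsto (fun n => ∫ ω, f ((posCount (X n ω) : ℝ) / n) ∂P) atTop
      (𝓝 (∫ ω, f (occupationProportion B t ω) ∂P)) := by
    refine tendsto_integral_of_dominated_convergence (fun _ => ‖f‖)
      (fun n => (f.continuous.measurable.comp_aemeasurable (hmeas n)).aestronglyMeasurable)
      (integrable_const _) (fun n => Eventually.of_forall fun ω => f.norm_coe_le_norm _) ?_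
    filter_upwards [hlim] with ω hω using (f.continuous.tendsto _).comp hω
  have h₂ : Tendsto (fun n => ∫ ω, f ((posCount (X n ω) : ℝ) / n) ∂P) atTop
      (𝓝 (∫ x, f x ∂arcsineMeasure)) := by
    refine (tendsto_integral_posCount_div (fun n => gaussianReal 0 (t / n)) ?_
      (fun n => by rw [gaussianReal_map_neg, neg_zero]) f).congr fun n => ?_
    · filter_upwards [eventually_ne_atTop 0] with n hn
      exact nullSingletonClass_gaussianReal (by positivity)
    · have hf : Measurable fun x : Fin n → ℝ => f ((posCount x : ℝ) / n) :=
        f.continuous.measurable.comp ((measurable_from_nat.comp measurable_posCount).div_const _)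
      exact ((hX n).integral_comp hf.aestronglyMeasurable).symm
  exact tendsto_nhds_unique h₁ h₂
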